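/- Notation. Let $K=SO(2)\times SO(2)$, let $R(\theta)=\begin{pmatrix}\cos\theta&\sin\theta\\-\sin\theta&\cos\theta\end{pmatrix}$, and let $C_n\le SO(2)$ be the cyclic subgroup of order $n$ generated by $R(2\pi/n)$. A subgroup of $C_n\times C_m\le K$ is in *class $E_1$* if it has even order, contains $\{(I,I),(-I,-I)\}$, and does not contain $\{(I,I),(-I,I),(I,-I),(-I,-I)\}$. A group *has two generators* if it is generated by two elements but is not cyclic. "Direct product" means internal direct product of subgroups. Proposition. Let $n,m$ be positive even integers, $n=\prod_{i=1}^s p_i^{a_i}$, $m=\prod_{i=1}^s p_i^{b_i}$, with distinct primes $p_1=2,p_2,\dots,p_s$ and $a_i,b_i\ge 0$. Then $a_1,b_1\ge1$, the primes $p_2,\dots,p_s$ are odd, and $C_n\times C_m$ is the direct product of the groups $C_{p_i^{a_i}}\times C_{p_i^{b_i}}$, $1\le i\le s$. Let $\mathcal C$ be a subgroup of $C_n\times C_m$ with two generators which is in class $E_1$. Then: (1) $\mathcal C$ is written uniquely as a direct product $\mathcal C=A_1\times\cdots\times A_s$ with $A_i\le C_{p_i^{a_i}}\times C_{p_i^{b_i}}$.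 The group $A_1$ is nontrivial and cyclic, and there is exactly one pair $(k,r)$ with $1\le k\le\min(a_1,b_1)$ and $r$ odd, $1\le r\le 2^k-1$, such that $i_1\mapsto\left(R\left(\tfrac{2\pi}{2^k}r\,i_1\right),R\left(\tfrac{2\pi}{2^k}i_1\right)\right)$ is a bijection from $\{0,1,\dots,2^k-1\}$ onto $A_1$. At least one $A_i$ with $i\ge2$ has two generators. (2) For every generator $x$ of $C_n$ and every generator $y$ of $C_m$, the group $\mathcal C$ is generated by the two elements $(x^{\mathcal A_1},y^{\mathcal B_1})$ and $(x^{\mathcal A_2},y^{\mathcal B_2})$, where $$\mathcal A_1=\sum_i \alpha_i\frac{n}{p_i^{a_i}},\quad \mathcal B_1=\sum_i \beta_i\frac{m}{p_i^{b_i}},\quad \mathcal A_2=\sum_i \alpha'_i\frac{n}{p_i^{a_i}},\quad \mathcal B_2=\sum_i \beta'_i\frac{m}{p_i^{b_i}},$$ for some assignment of each index $i\in\{1,\dots,s\}$ to one of the following nine types and some integers $k_i,l_i,c_i\ge0$ in the ranges listed (write $p,a,b,k,l,c$ for $p_i,a_i,b_i,k_i,l_i,c_i$): - type $\nu$: $k\le\min(a,b)$,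 $0\le c<p^k$; $\ \alpha=c\,p^{a-k},\ \beta=p^{b-k},\ \alpha'=\beta'=0$; - type $\chi$: $1\le k\le\min(a,b)$, $0\le c<p^{k-1}$; $\ \alpha=p^{a-k},\ \beta=c\,p^{b-k+1},\ \alpha'=\beta'=0$; - type $\tau$: $a<k\le b$, $0\le c<p^a$; $\ \alpha=c,\ \beta=p^{b-k},\ \alpha'=\beta'=0$; - type $\psi$: $b<k\le a$, $0\le c<p^b$; $\ \alpha=p^{a-k},\ \beta=c,\ \alpha'=\beta'=0$; - type $\sigma$: $1\le l\le k\le\min(a,b)$, $0\le c<p^{k-l}$; $\ \alpha=c\,p^{a-k},\ \beta=p^{b-k},\ \alpha'=p^{a-l},\ \beta'=0$; - type $\theta$: $1\le l<k\le\min(a,b)$, $0\le c<p^{k-l-1}$; $\ \alpha=p^{a-k},\ \beta=c\,p^{b-k+1},\ \alpha'=0,\ \beta'=p^{b-l}$; - type $\phi$: $1\le l\le a<k\le b$, $0\le c<p^{a-l}$; $\ \alpha=c,\ \beta=p^{b-k},\ \alpha'=p^{a-l},\ \beta'=0$; - type $\xi$: $1\le l\le b<k\le a$, $0\le c<p^{b-l}$;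 $\ \alpha=p^{a-k},\ \beta=c,\ \alpha'=0,\ \beta'=p^{b-l}$; - the remaining indices: $\alpha=\beta=\alpha'=\beta'=0$. Moreover the index $1$ of the prime $2$ has type $\nu$ with $c_1$ odd (so $k_1\ge1$), and at least one index $i$ has one of the types $\sigma,\theta,\phi,\xi$ and satisfies $a_ib_i\ne0$. -/

import Mathlib

namespace TorusSubgroups

/-- The group `SO(2)` of real `2 × 2` orthogonal matrices of determinant one. -/
abbrev SO2 : Type := Matrix.specialOrthogonalGroup (Fin 2) ℝ

/-- The group `K = SO(2) × SO(2)`. -/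
abbrev K : Type := SO2 × SO2

/-- The rotation `R(θ)`, with rows `(cos θ, sin θ)` and `(-sin θ, cos θ)`. -/
noncomputable def R (θ : ℝ) : SO2 :=
  ⟨!![Real.cos θ, Real.sin θ; -Real.sin θ, Real.cos θ], by
    rw [Matrix.of_mem_specialOrthogonalGroup_fin_two_iff]
    refine ⟨rfl, by ring, ?_⟩
    have h := Real.sin_sq_add_cos_sq θ
    nlinarith⟩

/-- The element `-I` of `SO(2)`. -/
def negI : SO2 :=
  ⟨-1, by
    rw [Matrix.mem_specialOrthogonalGroup_fin_two_iff]
    simp⟩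

/-- The cyclic subgroup `C_n` of `SO(2)` of order `n` (for `n ≥ 1`), generated by the rotation
through the angle `2π/n`. -/
noncomputable def Cyc (n : ℕ) : Subgroup SO2 := Subgroup.zpowers (R (2 * Real.pi / n))

/-- The subgroup `C_n × C_m` of `SO(2) × SO(2)`. -/
noncomputable def CycProd (n m : ℕ) : Subgroup K := (Cyc n).prod (Cyc m)

/-- The class `E₁` of subgroups of `C_n × C_m`: the subgroups `C` of even order which contain
`A = {(I,I), (-I,-I)}` but do not contain
`D = {(I,I), (-I,I), (I,-I), (-I,-I)}`. -/
structure InClassE1 (n m : ℕ) (C : Subgroup K) : Prop where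
  le_cycProd : C ≤ CycProd n m
  even_card : Even (Nat.card C)
  contains_A : ({(1, 1), (negI, negI)} : Set K) ⊆ C
  not_contains_D : ¬ ({(1, 1), (negI, 1), (1, negI), (negI, negI)} : Set K) ⊆ C

/-- A group "with two generators": it is generated by two elements, but not by a single one. -/
def HasTwoGenerators (C : Subgroup K) : Prop :=
  ¬ IsCyclic C ∧ ∃ g h : K, C = Subgroup.closure {g, h}

/-- `C` is the (internal) direct product of its subgroups `A i`. The elements of the `A i` commute
because `K` is commutative. -/
def IsDirectProduct {s : ℕ} (C : Subgroup K) (A : Fin s → Subgroup K) : Prop :=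
  iSupIndep A ∧ ⨆ i, A i = C

/-- The blocks into which the indices `i` (equivalently the primes `p i`) are sorted.
In the first four blocks the `p`-component of the group is cyclic, of order `p ^ k`; in the next
four it has two generators, of orders `p ^ k` and `p ^ l`; an index in the block `rest` does
not occur in the sums (its component is trivial). -/
inductive Block
  | nu | chi | tau | psi | sigma | theta | phi | xi | rest

namespace Block

/-- The blocks of components with two generators. -/
def IsTwoGen : Block → Prop
  | sigma | theta | phi | xi => True
  | nu | chi | tau | psi | rest => False

/-- The ranges of the parameters attached to a prime `p` with exponents `a`, `b` in each block.
The coefficient `c` is called `r`, `ρ`, `j`, `j`, `r`, `ρ`, `t`, `t` in the successive blocks. -/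
def Admissible (p a b k l c : ℕ) : Block → Prop
  | nu => k ≤ min a b ∧ c < p ^ k
  | chi => 1 ≤ k ∧ k ≤ min a b ∧ c < p ^ (k - 1)
  | tau => a < k ∧ k ≤ b ∧ c < p ^ a
  | psi => b < k ∧ k ≤ a ∧ c < p ^ b
  | sigma => 1 ≤ l ∧ l ≤ k ∧ k ≤ min a b ∧ c < p ^ (k - l)
  | theta => 1 ≤ l ∧ l < k ∧ k ≤ min a b ∧ c < p ^ (k - l - 1)
  | phi => 1 ≤ l ∧ l ≤ a ∧ a < k ∧ k ≤ b ∧ c < p ^ (a - l)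
  | xi => 1 ≤ l ∧ l ≤ b ∧ b < k ∧ k ≤ a ∧ c < p ^ (b - l)
  | rest => True

/-- The factor of `n / p ^ a` in the sum `𝒜₁`. -/
def coeffA1 (p a k c : ℕ) : Block → ℕ
  | nu => c * p ^ (a - k)
  | chi => p ^ (a - k)
  | tau => c
  | psi => p ^ (a - k)
  | sigma => c * p ^ (a - k)
  | theta => p ^ (a - k)
  | phi => c
  | xi => p ^ (a - k)
  | rest => 0

/-- The factor of `m / p ^ b` in the sum `ℬ₁`. -/
def coeffB1 (p b k c : ℕ) : Block → ℕ
  | nu => p ^ (b - k)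
  | chi => c * p ^ (b - k + 1)
  | tau => p ^ (b - k)
  | psi => c
  | sigma => p ^ (b - k)
  | theta => c * p ^ (b - k + 1)
  | phi => p ^ (b - k)
  | xi => c
  | rest => 0

/-- The factor of `n / p ^ a` in the sum `𝒜₂`. -/
def coeffA2 (p a l : ℕ) : Block → ℕ
  | sigma | phi => p ^ (a - l)
  | nu | chi | tau | psi | theta | xi | rest => 0

/-- The factor of `m / p ^ b` in the sum `ℬ₂`. -/
def coeffB2 (p b l : ℕ) : Block → ℕ
  | theta | xi => p ^ (b - l)
  | nu | chi | tau | psi | sigma | phi | rest => 0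

end Block

section Exponents

variable {s : ℕ} (p a b k l c : Fin s → ℕ) (ty : Fin s → Block)

/-- The exponent `𝒜₁` of `x` in the first generator, where `n = ∏ i, p i ^ a i`. -/
def expA1 (n : ℕ) : ℕ := ∑ i, (ty i).coeffA1 (p i) (a i) (k i) (c i) * (n / p i ^ a i)

/-- The exponent `ℬ₁` of `y` in the first generator, where `m = ∏ i, p i ^ b i`. -/
def expB1 (m : ℕ) : ℕ := ∑ i, (ty i).coeffB1 (p i) (b i) (k i) (c i) * (m / p i ^ b i)

/-- The exponent `𝒜₂` of `x` in the second generator. -/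
def expA2 (n : ℕ) : ℕ := ∑ i, (ty i).coeffA2 (p i) (a i) (l i) * (n / p i ^ a i)

/-- The exponent `ℬ₂` of `y` in the second generator. -/
def expB2 (m : ℕ) : ℕ := ∑ i, (ty i).coeffB2 (p i) (b i) (l i) * (m / p i ^ b i)

end Exponents

end TorusSubgroups

namespace TorusSubgroups

/-! ### Subgroups of a cyclic `p`-group. -/

section CyclicPGroups

variable {U : Type*} [CommGroup U] {g u : U} {p a : ℕ}

/-! Let `P i` be the `p i`-primary part of `C_n × C_m`. The numbers `p i ^ (a i + b i)` are pairwise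
coprime and kill the `P i`, so the Chinese remainder theorem makes the `P i` independent and splits
`C` as the join of the `C ⊓ P i`. Independence also forces the components of any such decomposition
to be `C ⊓ P i` (`eq_iSup_inf_of_iSupIndep`).

Each component `H` lies in a product of two cyclic `p`-groups. Its exponent `p ^ k` is attained in
one coordinate, by some `z`. A suitable power of `z`, together with a generator of the kernel of the
projection to that coordinate, generates `H`. The kernel is a subgroup of a cyclic `p`-group, hence
cyclic. Which coordinate is used, how `k` compares with `a` or `b`, and whether the kernel is
trivial give eight blocks (`exists_block_closure_eq`); the trivial group is `nu` with `k = 0`.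

At the prime 2, class `E₁` says that `(-I, -I)` is the only involution of `C`. Both projections of
the component are then injective, so it is the graph of an isomorphism, which gives `nu` with odd
`c` (`exists_eq_zpowers_of_unique_involution`).

By coprimality, multiplying the first generators together, and likewise the second ones, gives two
generators of `C` (`closure_prod_pair_eq_iSup`). If all components were cyclic, or all second
generators trivial, `C` would be cyclic. -/

theorem orderOf_pow_prime_pow_sub (hp : p.Prime) (hg : orderOf g = p ^ a) {t : ℕ} (ht : t ≤ a) :
    orderOf (g ^ p ^ (a - t)) = p ^ t := by
  rw [orderOf_pow_of_dvd (pow_ne_zero _ hp.ne_zero) (hg ▸ pow_dvd_pow p (Nat.sub_le a t)), hg,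
    Nat.pow_div (Nat.sub_le a t) hp.pos, Nat.sub_sub_self ht]

theorem mem_zpowers_pow_of_pow_eq_one (hp : p.Prime) (hg : orderOf g = p ^ a) {t : ℕ} (ht : t ≤ a)
    (hu : u ∈ Subgroup.zpowers g) (hut : u ^ p ^ t = 1) :
    u ∈ Subgroup.zpowers (g ^ p ^ (a - t)) := by
  obtain ⟨i, rfl⟩ := hu
  simp only [← zpow_natCast, ← zpow_mul] at hut
  have h1 : ((p ^ a : ℕ) : ℤ) ∣ i * ((p ^ t : ℕ) : ℤ) := by
    rw [← hg]; exact orderOf_dvd_iff_zpow_eq_one.2 hut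
  have h2 : p ^ a = p ^ (a - t) * p ^ t := by rw [← pow_add, Nat.sub_add_cancel ht]
  rw [h2, Nat.cast_mul] at h1
  obtain ⟨j, rfl⟩ := Int.dvd_of_mul_dvd_mul_right
    (by exact_mod_cast pow_ne_zero t hp.ne_zero) h1
  exact ⟨j, by simp only [← zpow_natCast, ← zpow_mul]⟩

/-- A subgroup of order `p ^ l` lies in the `p ^ l`-torsion, which itself has only `p ^ l` elements.
-/
theorem exists_eq_zpowers_pow_of_le (hp : p.Prime) (hg : orderOf g = p ^ a) {N : Subgroup U}
    (hN : N ≤ Subgroup.zpowers g) : ∃ l ≤ a, N = Subgroup.zpowers (g ^ p ^ (a - l)) := by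
  have hcard : Nat.card N ∣ p ^ a := by
    rw [← hg, ← Nat.card_zpowers]; exact Subgroup.card_dvd_of_le hN
  obtain ⟨l, hl, hNl⟩ := (Nat.dvd_prime_pow hp).1 hcard
  refine ⟨l, hl, ?_⟩
  have hord := orderOf_pow_prime_pow_sub hp hg hl
  have : Finite (Subgroup.zpowers (g ^ p ^ (a - l))) :=
    Nat.finite_of_card_ne_zero (by rw [Nat.card_zpowers, hord]; exact pow_ne_zero _ hp.ne_zero)
  refine Subgroup.eq_of_le_of_card_ge (fun u hu => ?_) (by rw [Nat.card_zpowers, hord, hNl])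
  refine mem_zpowers_pow_of_pow_eq_one hp hg hl (hN hu) ?_
  have := pow_card_eq_one' (G := N) (x := ⟨u, hu⟩)
  rw [hNl] at this
  exact congrArg Subtype.val this

theorem exists_nat_pow_eq_of_mem_zpowers (h : 0 < orderOf g) (hu : u ∈ Subgroup.zpowers g) :
    ∃ i : ℕ, g ^ i = u :=
  ((orderOf_pos_iff.1 h).mem_powers_iff_mem_zpowers).2 hu

theorem pow_pow_eq_one_of_le {i j : ℕ} (hij : i ≤ j) (hu : u ^ p ^ i = 1) : u ^ p ^ j = 1 :=
  orderOf_dvd_iff_pow_eq_one.1 ((orderOf_dvd_of_pow_eq_one hu).trans (pow_dvd_pow p hij))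

/-- Every nontrivial subgroup of a cyclic `p`-group contains its subgroup of order `p`. -/
theorem eq_bot_of_pow_notMem (hp : p.Prime) (hg : orderOf g = p ^ a)
    {N : Subgroup U} (hN : N ≤ Subgroup.zpowers g) (hgN : g ^ p ^ (a - 1) ∉ N) : N = ⊥ := by
  obtain ⟨l, hl, rfl⟩ := exists_eq_zpowers_pow_of_le hp hg hN
  rcases Nat.eq_zero_or_pos l with rfl | hl0
  · rw [Nat.sub_zero, ← hg, pow_orderOf_eq_one, Subgroup.zpowers_one_eq_bot]
  · refine absurd ?_ hgN
    have : g ^ p ^ (a - 1) = (g ^ p ^ (a - l)) ^ p ^ (l - 1) := by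
      rw [← pow_mul, ← pow_add]; congr 2; omega
    rw [this]
    exact Subgroup.pow_mem _ (Subgroup.mem_zpowers _) _

end CyclicPGroups

/-! ### Subgroups of a product of two cyclic `p`-groups. -/

section TwoCyclicFactors

variable {U V : Type*} [CommGroup U] [CommGroup V] {g : U} {h : V} {p a b : ℕ}
  {H : Subgroup (U × V)}

/-- The second coordinate of `z` generates the second projection of `H`, so `H` is generated by a
power of `z` and the kernel of that projection, a cyclic group of order `p ^ l`. Changing that power
by kernel elements makes `c` matter only modulo `p ^ (t - l)`. -/
theorem exists_closure_pair_of_orderOf_snd (hp : p.Prime) (hg : orderOf g = p ^ a)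
    (hh : orderOf h = p ^ b) (hH : H ≤ (Subgroup.zpowers g).prod (Subgroup.zpowers h))
    {t k : ℕ} (ht : t ≤ a) (hk : k ≤ b) (h1 : ∀ w ∈ H, w.1 ^ p ^ t = 1)
    (h2 : ∀ w ∈ H, w.2 ^ p ^ k = 1) (hz : ∃ z ∈ H, orderOf z.2 = p ^ k) :
    ∃ l ≤ t, ∃ c < p ^ (t - l), (g ^ p ^ (a - l), 1) ∈ H ∧
      H = Subgroup.closure {(g ^ (c * p ^ (a - t)), h ^ p ^ (b - k)), (g ^ p ^ (a - l), 1)} := by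
  have hgt := orderOf_pow_prime_pow_sub hp hg ht
  set g' := g ^ p ^ (a - t) with hg'
  have hH1 : ∀ w ∈ H, w.1 ∈ Subgroup.zpowers g' := fun w hw =>
    mem_zpowers_pow_of_pow_eq_one hp hg ht (hH hw).1 (h1 w hw)
  have hH2 : ∀ w ∈ H, w.2 ∈ Subgroup.zpowers (h ^ p ^ (b - k)) := fun w hw =>
    mem_zpowers_pow_of_pow_eq_one hp hh hk (hH hw).2 (h2 w hw)
  obtain ⟨l, hl, hN⟩ := exists_eq_zpowers_pow_of_le hp hgt
    (N := H.comap (MonoidHom.inl U V)) (fun u hu => hH1 (u, 1) hu)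
  have hpow : g' ^ p ^ (t - l) = g ^ p ^ (a - l) := by
    rw [hg', ← pow_mul, ← pow_add]; congr 2; omega
  rw [hpow] at hN
  have hker : (g ^ p ^ (a - l), (1 : V)) ∈ H := by
    have : g ^ p ^ (a - l) ∈ H.comap (MonoidHom.inl U V) := hN ▸ Subgroup.mem_zpowers _
    exact this
  obtain ⟨z, hzH, hzo⟩ := hz
  -- `z.2` generates the whole `p ^ k`-torsion of `⟨h⟩`, so some power of `z` has exactly the
  -- prescribed second coordinate.
  obtain ⟨j, hj⟩ : h ^ p ^ (b - k) ∈ Subgroup.zpowers z.2 := by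
    have hle : Subgroup.zpowers z.2 ≤ Subgroup.zpowers (h ^ p ^ (b - k)) :=
      Subgroup.zpowers_le.2 (hH2 z hzH)
    have hord := orderOf_pow_prime_pow_sub hp hh hk
    have : Finite (Subgroup.zpowers (h ^ p ^ (b - k))) :=
      Nat.finite_of_card_ne_zero (by rw [Nat.card_zpowers, hord]; exact pow_ne_zero _ hp.ne_zero)
    rw [Subgroup.eq_of_le_of_card_ge hle (by rw [Nat.card_zpowers, Nat.card_zpowers, hord, hzo])]
    exact Subgroup.mem_zpowers _
  obtain ⟨i, hi⟩ := exists_nat_pow_eq_of_mem_zpowers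
    (by rw [hgt]; exact pow_pos hp.pos t) (hH1 _ (H.zpow_mem hzH j))
  have hw : (g ^ (i % p ^ (t - l) * p ^ (a - t)), h ^ p ^ (b - k)) ∈ H := by
    have h3 : (g' ^ i, h ^ p ^ (b - k)) ∈ H := by
      have : z ^ j = (g' ^ i, h ^ p ^ (b - k)) := Prod.ext hi.symm hj
      rw [← this]; exact H.zpow_mem hzH j
    -- The kernel generator is `g' ^ p ^ (t - l)`; dividing by its power `i / p ^ (t - l)` leaves
    -- the remainder of `i` as exponent.
    have h4 := H.mul_mem h3 (H.inv_mem (H.pow_mem hker (i / p ^ (t - l))))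
    convert h4 using 1
    refine Prod.ext ?_ ?_
    · simp only [Prod.pow_mk, Prod.inv_mk, Prod.mk_mul_mk]
      rw [eq_mul_inv_iff_mul_eq, ← hpow, ← pow_mul, mul_comm (i % _), pow_mul, ← hg', ← pow_add,
        Nat.mod_add_div]
    · simp
  refine ⟨l, hl, i % p ^ (t - l), Nat.mod_lt _ (pow_pos hp.pos _), hker, le_antisymm ?_ ?_⟩
  · intro w hwH
    obtain ⟨e, he⟩ := hH2 w hwH
    set z' := (g ^ (i % p ^ (t - l) * p ^ (a - t)), h ^ p ^ (b - k)) with hz'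
    have h5 : w * (z' ^ e)⁻¹ ∈ H := H.mul_mem hwH (H.inv_mem (H.zpow_mem hw e))
    have h6 : w * (z' ^ e)⁻¹ = MonoidHom.inl U V (w * (z' ^ e)⁻¹).1 := by
      refine Prod.ext rfl ?_
      simp only [MonoidHom.inl_apply, Prod.snd_mul, Prod.snd_inv]
      rw [mul_inv_eq_one]; exact he.symm
    have h7 : (w * (z' ^ e)⁻¹).1 ∈ Subgroup.zpowers (g ^ p ^ (a - l)) := by
      rw [← hN, Subgroup.mem_comap, ← h6]; exact h5
    obtain ⟨d, hd⟩ := h7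
    refine Subgroup.mem_closure_pair.2 ⟨e, d, ?_⟩
    have h8 : ((g ^ p ^ (a - l), 1) : U × V) ^ d = w * (z' ^ e)⁻¹ := by
      rw [h6]; exact Prod.ext hd (by simp)
    rw [h8, mul_comm, inv_mul_cancel_right]
  · rw [Subgroup.closure_le]
    rintro w (rfl | rfl)
    exacts [hw, hker]

/-- The mirror image, transported along the swap of the factors. -/
theorem exists_closure_pair_of_orderOf_fst (hp : p.Prime) (hg : orderOf g = p ^ a)
    (hh : orderOf h = p ^ b) (hH : H ≤ (Subgroup.zpowers g).prod (Subgroup.zpowers h))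
    {t k : ℕ} (ht : t ≤ b) (hk : k ≤ a) (h1 : ∀ w ∈ H, w.1 ^ p ^ k = 1)
    (h2 : ∀ w ∈ H, w.2 ^ p ^ t = 1) (hz : ∃ z ∈ H, orderOf z.1 = p ^ k) :
    ∃ l ≤ t, ∃ c < p ^ (t - l), (1, h ^ p ^ (b - l)) ∈ H ∧
      H = Subgroup.closure {(g ^ p ^ (a - k), h ^ (c * p ^ (b - t))), (1, h ^ p ^ (b - l))} := by
  let e : U × V ≃* V × U := MulEquiv.prodComm
  have hmem : ∀ w, w ∈ H.map e.toMonoidHom ↔ e.symm w ∈ H := fun w =>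
    Subgroup.mem_map_equiv
  obtain ⟨l, hl, c, hc, hker, hcl⟩ := exists_closure_pair_of_orderOf_snd
    (H := H.map e.toMonoidHom) hp hh hg
    (fun w hw => ⟨(hH ((hmem w).1 hw)).2, (hH ((hmem w).1 hw)).1⟩) ht hk
    (fun w hw => h2 _ ((hmem w).1 hw)) (fun w hw => h1 _ ((hmem w).1 hw))
    (by
      obtain ⟨z, hz, hzo⟩ := hz
      exact ⟨e z, (hmem _).2 (by simpa using hz), hzo⟩)
  refine ⟨l, hl, c, hc, (hmem _).1 hker, ?_⟩
  apply Subgroup.map_injective (f := e.toMonoidHom) e.injective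
  change H.map e.toMonoidHom = Subgroup.map e.toMonoidHom _
  rw [hcl, MonoidHom.map_closure, Set.image_pair]
  rfl

/-- Normal form of the subgroups of a product of two finite cyclic `p`-groups. -/
theorem exists_block_closure_eq (hp : p.Prime) (hg : orderOf g = p ^ a)
    (hh : orderOf h = p ^ b) (hH : H ≤ (Subgroup.zpowers g).prod (Subgroup.zpowers h)) :
    ∃ (ty : Block) (k l c : ℕ), ty.Admissible p a b k l c ∧
      H = Subgroup.closure {(g ^ ty.coeffA1 p a k c, h ^ ty.coeffB1 p b k c),
        (g ^ ty.coeffA2 p a l, h ^ ty.coeffB2 p b l)} := by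
  classical
  have hga : ∀ w ∈ H, w.1 ^ p ^ a = 1 := fun w hw =>
    orderOf_dvd_iff_pow_eq_one.1 (hg ▸ orderOf_dvd_of_mem_zpowers (hH hw).1)
  have hhb : ∀ w ∈ H, w.2 ^ p ^ b = 1 := fun w hw =>
    orderOf_dvd_iff_pow_eq_one.1 (hh ▸ orderOf_dvd_of_mem_zpowers (hH hw).2)
  have hex : ∃ k, ∀ w ∈ H, w ^ p ^ k = 1 := ⟨max a b, fun w hw =>
    Prod.ext (pow_pow_eq_one_of_le (le_max_left a b) (hga w hw))
      (pow_pow_eq_one_of_le (le_max_right a b) (hhb w hw))⟩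
  obtain ⟨k, hk, hmin⟩ : ∃ k, (∀ w ∈ H, w ^ p ^ k = 1) ∧
      ∀ j < k, ¬ ∀ w ∈ H, w ^ p ^ j = 1 :=
    ⟨Nat.find hex, Nat.find_spec hex, fun j hj => Nat.find_min hex hj⟩
  have hk1 : ∀ w ∈ H, w.1 ^ p ^ k = 1 := fun w hw => congrArg Prod.fst (hk w hw)
  have hk2 : ∀ w ∈ H, w.2 ^ p ^ k = 1 := fun w hw => congrArg Prod.snd (hk w hw)
  have hmin1 : ∀ j, (∀ w ∈ H, w.1 ^ p ^ j = 1) → ∀ w ∈ H, w.1 ^ p ^ min j a = 1 := by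
    intro j hj w hw
    rcases min_choice j a with h | h <;> rw [h]
    exacts [hj w hw, hga w hw]
  have hmin2 : ∀ j, (∀ w ∈ H, w.2 ^ p ^ j = 1) → ∀ w ∈ H, w.2 ^ p ^ min j b = 1 := by
    intro j hj w hw
    rcases min_choice j b with h | h <;> rw [h]
    exacts [hj w hw, hhb w hw]
  -- The second coordinate is preferred when both attain the exponent; this tie-break is why `chi`
  -- and `theta` carry the stricter range of `c`.
  by_cases hmax : ∃ z ∈ H, orderOf z.2 = p ^ k
  · have hkb : k ≤ b := by
      obtain ⟨z, hz, hzo⟩ := hmax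
      exact (Nat.pow_dvd_pow_iff_le_right hp.one_lt).1
        (hzo ▸ orderOf_dvd_of_pow_eq_one (hhb z hz))
    obtain ⟨l, hl, c, hc, -, hcl⟩ := exists_closure_pair_of_orderOf_snd hp hg hh hH
      (min_le_right k a) hkb (hmin1 k hk1) hk2 hmax
    rcases le_or_gt k a with hka | hka
    · rw [min_eq_left hka] at hl hc hcl
      rcases Nat.eq_zero_or_pos l with rfl | hl0
      · refine ⟨.nu, k, 0, c, ⟨le_min hka hkb, by simpa using hc⟩, ?_⟩
        have : g ^ p ^ (a - 0) = 1 := by rw [Nat.sub_zero, ← hg, pow_orderOf_eq_one]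
        rw [this] at hcl
        simpa [Block.coeffA1, Block.coeffB1, Block.coeffA2, Block.coeffB2] using hcl
      · exact ⟨.sigma, k, l, c, ⟨hl0, hl, le_min hka hkb, hc⟩, by
          simpa [Block.coeffA1, Block.coeffB1, Block.coeffA2, Block.coeffB2] using hcl⟩
    · rw [min_eq_right hka.le] at hl hc hcl
      rw [Nat.sub_self, pow_zero, mul_one] at hcl
      rcases Nat.eq_zero_or_pos l with rfl | hl0
      · refine ⟨.tau, k, 0, c, ⟨hka, hkb, by simpa using hc⟩, ?_⟩
        have : g ^ p ^ (a - 0) = 1 := by rw [Nat.sub_zero, ← hg, pow_orderOf_eq_one]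
        rw [this] at hcl
        simpa [Block.coeffA1, Block.coeffB1, Block.coeffA2, Block.coeffB2] using hcl
      · exact ⟨.phi, k, l, c, ⟨hl0, hl, hka, hkb, hc⟩, by
          simpa [Block.coeffA1, Block.coeffB1, Block.coeffA2, Block.coeffB2] using hcl⟩
  -- The identity attains order `p ^ 0`, so here `k ≥ 1`. All second coordinates are killed by `p ^
  -- q`, and minimality of `k` makes a first coordinate attain `p ^ (q + 1)`.
  · obtain ⟨q, rfl⟩ : ∃ q, k = q + 1 := by
      refine Nat.exists_eq_succ_of_ne_zero ?_
      rintro rfl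
      exact hmax ⟨1, H.one_mem, by simp⟩
    have hq2 : ∀ w ∈ H, w.2 ^ p ^ q = 1 := fun w hw => by
      by_contra hne
      exact hmax ⟨w, hw, by
        have := Fact.mk hp
        exact orderOf_eq_prime_pow hne (hk2 w hw)⟩
    have hmax1 : ∃ z ∈ H, orderOf z.1 = p ^ (q + 1) := by
      have := hmin q q.lt_succ_self
      push Not at this
      obtain ⟨z, hz, hzne⟩ := this
      have := Fact.mk hp
      exact ⟨z, hz, orderOf_eq_prime_pow (fun h => hzne (Prod.ext h (hq2 z hz))) (hk1 z hz)⟩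
    have hka : q + 1 ≤ a := by
      obtain ⟨z, hz, hzo⟩ := hmax1
      exact (Nat.pow_dvd_pow_iff_le_right hp.one_lt).1
        (hzo ▸ orderOf_dvd_of_pow_eq_one (hga z hz))
    obtain ⟨l, hl, c, hc, -, hcl⟩ := exists_closure_pair_of_orderOf_fst hp hg hh hH
      (min_le_right q b) hka hk1 (hmin2 q hq2) hmax1
    rcases lt_or_ge q b with hqb | hqb
    · rw [min_eq_left hqb.le] at hl hc hcl
      -- The bound on the second coordinate is `q = k - 1`, whence the exponent `b - k + 1` in
      -- `coeffB1`.
      have hsub : b - q = b - (q + 1) + 1 := by omega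
      rw [hsub] at hcl
      rcases Nat.eq_zero_or_pos l with rfl | hl0
      · refine ⟨.chi, q + 1, 0, c, ⟨by omega, le_min hka hqb, by simpa using hc⟩, ?_⟩
        have : h ^ p ^ (b - 0) = 1 := by rw [Nat.sub_zero, ← hh, pow_orderOf_eq_one]
        rw [this] at hcl
        simpa [Block.coeffA1, Block.coeffB1, Block.coeffA2, Block.coeffB2] using hcl
      · refine ⟨.theta, q + 1, l, c, ⟨hl0, by omega, le_min hka hqb, ?_⟩, by
          simpa [Block.coeffA1, Block.coeffB1, Block.coeffA2, Block.coeffB2] using hcl⟩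
        rwa [show q + 1 - l - 1 = q - l by omega]
    · rw [min_eq_right hqb] at hl hc hcl
      rw [Nat.sub_self, pow_zero, mul_one] at hcl
      rcases Nat.eq_zero_or_pos l with rfl | hl0
      · refine ⟨.psi, q + 1, 0, c, ⟨by omega, hka, by simpa using hc⟩, ?_⟩
        have : h ^ p ^ (b - 0) = 1 := by rw [Nat.sub_zero, ← hh, pow_orderOf_eq_one]
        rw [this] at hcl
        simpa [Block.coeffA1, Block.coeffB1, Block.coeffA2, Block.coeffB2] using hcl
      · exact ⟨.xi, q + 1, l, c, ⟨hl0, hl, by omega, hka, hc⟩, by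
          simpa [Block.coeffA1, Block.coeffB1, Block.coeffA2, Block.coeffB2] using hcl⟩

/-- A subgroup of a product of two finite cyclic `2`-groups which contains the element
`(g ^ 2 ^ (a - 1), h ^ 2 ^ (b - 1))` of order two and no other one is the graph of an
isomorphism. -/
theorem exists_eq_zpowers_of_unique_involution (hb : 1 ≤ b)
    (hg : orderOf g = 2 ^ a) (hh : orderOf h = 2 ^ b)
    (hH : H ≤ (Subgroup.zpowers g).prod (Subgroup.zpowers h))
    (h11 : (g ^ 2 ^ (a - 1), h ^ 2 ^ (b - 1)) ∈ H) (h10 : (g ^ 2 ^ (a - 1), 1) ∉ H)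
    (h01 : (1, h ^ 2 ^ (b - 1)) ∉ H) :
    ∃ k c, 1 ≤ k ∧ k ≤ min a b ∧ c < 2 ^ k ∧ Odd c ∧
      H = Subgroup.zpowers (g ^ (c * 2 ^ (a - k)), h ^ 2 ^ (b - k)) := by
  classical
  have hp := Nat.prime_two
  have hga : ∀ w ∈ H, w.1 ^ 2 ^ a = 1 := fun w hw =>
    orderOf_dvd_iff_pow_eq_one.1 (hg ▸ orderOf_dvd_of_mem_zpowers (hH hw).1)
  have hhb : ∀ w ∈ H, w.2 ^ 2 ^ b = 1 := fun w hw =>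
    orderOf_dvd_iff_pow_eq_one.1 (hh ▸ orderOf_dvd_of_mem_zpowers (hH hw).2)
  -- A nontrivial kernel of a projection would contain the excluded involution.
  have hfst : ∀ w ∈ H, w.2 = 1 → w.1 = 1 := by
    rintro ⟨u, v⟩ hw (rfl : v = 1)
    have hbot := eq_bot_of_pow_notMem hp hg (N := H.comap (MonoidHom.inl U V))
      (fun u hu => (hH (show (u, 1) ∈ H from hu)).1) h10
    exact (Subgroup.mem_bot).1 (hbot ▸ (show u ∈ H.comap (MonoidHom.inl U V) from hw))
  have hsnd : ∀ w ∈ H, w.1 = 1 → w.2 = 1 := by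
    rintro ⟨u, v⟩ hw (rfl : u = 1)
    have hbot := eq_bot_of_pow_notMem hp hh (N := H.comap (MonoidHom.inr U V))
      (fun u hu => (hH (show (1, u) ∈ H from hu)).2) h01
    exact (Subgroup.mem_bot).1 (hbot ▸ (show v ∈ H.comap (MonoidHom.inr U V) from hw))
  have hfst' : ∀ w ∈ H, ∀ e : ℕ, w.2 ^ e = 1 → w.1 ^ e = 1 := fun w hw e =>
    hfst (w ^ e) (H.pow_mem hw e)
  have hsnd' : ∀ w ∈ H, ∀ e : ℕ, w.1 ^ e = 1 → w.2 ^ e = 1 := fun w hw e =>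
    hsnd (w ^ e) (H.pow_mem hw e)
  have hex : ∃ k, ∀ w ∈ H, w.2 ^ 2 ^ k = 1 := ⟨b, hhb⟩
  obtain ⟨k, hk, hmin⟩ : ∃ k, (∀ w ∈ H, w.2 ^ 2 ^ k = 1) ∧
      ∀ j, (∀ w ∈ H, w.2 ^ 2 ^ j = 1) → k ≤ j :=
    ⟨Nat.find hex, Nat.find_spec hex, fun j hj => Nat.find_min' hex hj⟩
  have hkb : k ≤ b := hmin b hhb
  have hka : k ≤ a := hmin a fun w hw => hsnd' w hw _ (hga w hw)
  have hk1 : 1 ≤ k := by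
    by_contra hk0
    obtain rfl : k = 0 := by omega
    have h1 := hk _ h11
    have h2 := orderOf_pow_prime_pow_sub hp hh hb
    rw [pow_zero, pow_one] at h1
    dsimp only at h1
    rw [h1, orderOf_one] at h2
    norm_num at h2
  obtain ⟨q, rfl⟩ := Nat.exists_eq_add_of_le' hk1
  have hz : ∃ z ∈ H, orderOf z.2 = 2 ^ (q + 1) := by
    by_contra! hne
    have := hmin q fun w hw => by
      by_contra hw1
      exact hne w hw (orderOf_eq_prime_pow hw1 (hk w hw))
    omega
  obtain ⟨l, hl, c, hc, hker, hcl⟩ := exists_closure_pair_of_orderOf_snd hp hg hh hH hka hkb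
    (fun w hw => hfst' w hw _ (hk w hw)) hk hz
  have hg1 : g ^ 2 ^ (a - l) = 1 := hfst _ hker rfl
  obtain rfl : l = 0 := by
    have := orderOf_pow_prime_pow_sub hp hg (hl.trans hka)
    rw [hg1, orderOf_one] at this
    by_contra hl0
    exact absurd this.symm (Nat.one_lt_two_pow hl0).ne'
  rw [hg1, ← Prod.one_eq_mk, Set.pair_comm, Subgroup.closure_insert_one,
    ← Subgroup.zpowers_eq_closure] at hcl
  refine ⟨q + 1, c, hk1, le_min hka hkb, by simpa using hc, ?_, hcl⟩
  -- For even `c`, the power `2 ^ q` would kill the first coordinate of the generator but not the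
  -- second, which has order `2 ^ (q + 1)`.
  by_contra hodd
  obtain ⟨d, rfl⟩ := (Nat.not_odd_iff_even.1 hodd).two_dvd
  have hzH := hcl ▸ Subgroup.mem_zpowers (g ^ (2 * d * 2 ^ (a - (q + 1))), h ^ 2 ^ (b - (q + 1)))
  have h1 := hsnd' _ hzH (2 ^ q) (by
    have : 2 * d * 2 ^ (a - (q + 1)) * 2 ^ q = 2 ^ a * d := by
      calc _ = (2 ^ (a - (q + 1)) * 2 ^ (q + 1)) * d := by ring
        _ = _ := by rw [← pow_add, Nat.sub_add_cancel hka]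
    change (g ^ (2 * d * 2 ^ (a - (q + 1)))) ^ 2 ^ q = 1
    rw [← pow_mul, this, ← hg, pow_mul, pow_orderOf_eq_one, one_pow])
  have h2 := orderOf_dvd_of_pow_eq_one h1
  rw [orderOf_pow_prime_pow_sub hp hh hkb, Nat.pow_dvd_pow_iff_le_right (by norm_num)] at h2
  omega

end TwoCyclicFactors

/-! ### Splitting by pairwise coprime exponents. -/

section CoprimeExponents

variable {G : Type*} [CommGroup G] {ι : Type*} [Fintype ι] {q : ι → ℕ}

/-- These exponents act as idempotents: raising to the power `e` fixes `q i`-torsion and kills `q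
j`-torsion for `j ≠ i`. -/
theorem exists_modEq_one_of_pairwise_coprime
    (hq : Pairwise fun i j => Nat.Coprime (q i) (q j)) (i : ι) :
    ∃ e : ℕ, e ≡ 1 [MOD q i] ∧ ∀ j, j ≠ i → q j ∣ e := by
  classical
  have hco : Nat.Coprime (q i) (∏ j ∈ Finset.univ.erase i, q j) :=
    Nat.Coprime.prod_right fun j hj => hq (Finset.ne_of_mem_erase hj).symm
  obtain ⟨e, h1, h0⟩ := Nat.chineseRemainder hco 1 0
  exact ⟨e, h1, fun j hj => (Finset.dvd_prod_of_mem q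
    (Finset.mem_erase.2 ⟨hj, Finset.mem_univ j⟩)).trans ((Nat.modEq_zero_iff_dvd).1 h0)⟩

/-- An idempotent exponent recovers each factor as a power of the full product, so no information is
lost in multiplying. -/
theorem closure_prod_pair_eq_iSup (hq : Pairwise fun i j => Nat.Coprime (q i) (q j))
    (z w : ι → G) (hz : ∀ i, z i ^ q i = 1) (hw : ∀ i, w i ^ q i = 1) :
    Subgroup.closure {∏ i, z i, ∏ i, w i} = ⨆ i, Subgroup.closure {z i, w i} := by
  classical
  have key : ∀ v : ι → G, (∀ i, v i ^ q i = 1) → ∀ i, v i ∈ Subgroup.zpowers (∏ j, v j) := by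
    intro v hv i
    obtain ⟨e, he1, he0⟩ := exists_modEq_one_of_pairwise_coprime hq i
    have : (∏ j, v j) ^ e = v i := by
      rw [← Finset.prod_pow, Finset.prod_eq_single i]
      · conv_rhs => rw [← pow_one (v i)]
        exact pow_eq_pow_iff_modEq.2 (he1.of_dvd (orderOf_dvd_of_pow_eq_one (hv i)))
      · intro j _ hj
        exact orderOf_dvd_iff_pow_eq_one.1
          ((orderOf_dvd_of_pow_eq_one (hv j)).trans (he0 j hj))
      · simp
    rw [← this]
    exact Subgroup.pow_mem _ (Subgroup.mem_zpowers _) _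
  apply le_antisymm
  · rw [Subgroup.closure_le]
    rintro v (rfl | rfl)
    · exact Subgroup.prod_mem _ fun i _ => Subgroup.mem_iSup_of_mem i
        (Subgroup.subset_closure (by simp))
    · exact Subgroup.prod_mem _ fun i _ => Subgroup.mem_iSup_of_mem i
        (Subgroup.subset_closure (by simp))
  · refine iSup_le fun i => ?_
    rw [Subgroup.closure_le]
    rintro v (rfl | rfl)
    · exact (Subgroup.zpowers_le.2 (Subgroup.subset_closure (by simp))) (key z hz i)
    · exact (Subgroup.zpowers_le.2 (Subgroup.subset_closure (by simp))) (key w hw i)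

/-- The idempotent exponents sum to 1 modulo the product of the `q i`, so `x` is the product of the
`x ^ e i`, each of them `q i`-torsion. -/
theorem le_of_pow_eq_one_imp_mem (hq : Pairwise fun i j => Nat.Coprime (q i) (q j))
    {C D : Subgroup G} (hC : ∀ x ∈ C, x ^ ∏ i, q i = 1)
    (hD : ∀ x ∈ C, ∀ i, x ^ q i = 1 → x ∈ D) : C ≤ D := by
  classical
  intro x hx
  choose e he1 he0 using exists_modEq_one_of_pairwise_coprime hq
  have hsum : x ^ ∑ i, e i = x := by
    have hdvd : ((∏ i, q i : ℕ) : ℤ) ∣ ((1 : ℕ) : ℤ) - ((∑ i, e i : ℕ) : ℤ) := by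
      rw [Nat.cast_prod]
      refine Finset.prod_dvd_of_coprime
        (fun i _ j _ hij => Nat.isCoprime_iff_coprime.2 (hq hij)) fun i _ => ?_
      rw [← Nat.modEq_iff_dvd, ← Finset.add_sum_erase _ _ (Finset.mem_univ i)]
      have h0 : ∑ j ∈ Finset.univ.erase i, e j ≡ 0 [MOD q i] :=
        (Nat.modEq_zero_iff_dvd).2 (Finset.dvd_sum fun j hj =>
          he0 j i (Finset.ne_of_mem_erase hj).symm)
      simpa using (he1 i).add h0
    conv_rhs => rw [← pow_one x]
    exact pow_eq_pow_iff_modEq.2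
      ((Nat.modEq_iff_dvd.2 hdvd).of_dvd (orderOf_dvd_of_pow_eq_one (hC x hx)))
  rw [← hsum, ← Finset.prod_pow_eq_pow_sum]
  refine Subgroup.prod_mem _ fun i _ => hD _ (C.pow_mem hx _) i ?_
  rw [← pow_mul]
  refine orderOf_dvd_iff_pow_eq_one.1 ((orderOf_dvd_of_pow_eq_one (hC x hx)).trans ?_)
  rw [← Finset.mul_prod_erase _ _ (Finset.mem_univ i), mul_comm]
  refine Nat.mul_dvd_mul ?_ dvd_rfl
  exact Finset.prod_dvd_of_isRelPrime
    (fun j _ k _ hjk => (Nat.coprime_iff_isRelPrime).1 (hq hjk))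
    fun j hj => he0 i j (Finset.ne_of_mem_erase hj)

theorem iSupIndep_of_pow_eq_one (hq : Pairwise fun i j => Nat.Coprime (q i) (q j))
    {P : ι → Subgroup G} (hP : ∀ i, ∀ x ∈ P i, x ^ q i = 1) : iSupIndep P := by
  intro i
  obtain ⟨e, he1, he0⟩ := exists_modEq_one_of_pairwise_coprime hq i
  rw [Subgroup.disjoint_def]
  intro x hx hx'
  have hle : ⨆ j, ⨆ (_ : j ≠ i), P j ≤ (powMonoidHom e : G →* G).ker :=
    iSup₂_le fun j hj y hy => orderOf_dvd_iff_pow_eq_one.1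
      ((orderOf_dvd_of_pow_eq_one (hP j y hy)).trans (he0 j hj))
  have h1 : x ^ e = 1 := hle hx'
  rw [← pow_one x, ← h1]
  exact pow_eq_pow_iff_modEq.2 (he1.symm.of_dvd (orderOf_dvd_of_pow_eq_one (hP i x hx)))

end CoprimeExponents

/-! ### Independent families and cyclic subgroups. -/

section CommGroup

variable {G : Type*} [CommGroup G]

theorem eq_iSup_inf_of_iSupIndep {ι : Type*} {P A : ι → Subgroup G} (hP : iSupIndep P)
    (hA : ∀ i, A i ≤ P i) (i : ι) : A i = (⨆ j, A j) ⊓ P i := by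
  refine le_antisymm (le_inf (le_iSup A i) (hA i)) ?_
  rintro x ⟨hx, hxP⟩
  have hsplit : ⨆ j, A j ≤ A i ⊔ ⨆ j, ⨆ (_ : j ≠ i), A j := iSup_le fun j => by
    rcases eq_or_ne j i with rfl | hj
    · exact le_sup_left
    · exact le_sup_of_le_right (le_iSup₂_of_le j hj le_rfl)
  obtain ⟨y, hy, w, hw, rfl⟩ := Subgroup.mem_sup.1 (hsplit hx)
  have hwP : w ∈ P i := by
    simpa using (P i).mul_mem ((P i).inv_mem (hA i hy)) hxP
  have : w = 1 := Subgroup.disjoint_def.1 (hP i) hwP (iSup₂_mono (fun j _ => hA j) hw)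
  rwa [this, mul_one]

theorem isCyclic_closure_pair_one (z : G) : IsCyclic (Subgroup.closure ({z, 1} : Set G)) := by
  rw [Set.pair_comm, Subgroup.closure_insert_one, ← Subgroup.zpowers_eq_closure]
  infer_instance

theorem bijOn_pow_zpowers {z : G} (hz : 0 < orderOf z) :
    Set.BijOn (fun i : ℕ => z ^ i) (Set.Iio (orderOf z)) (Subgroup.zpowers z) := by
  refine ⟨fun i _ => Subgroup.pow_mem _ (Subgroup.mem_zpowers z) i, pow_injOn_Iio_orderOf, ?_⟩
  intro w hw
  obtain ⟨i, rfl⟩ := exists_nat_pow_eq_of_mem_zpowers hz hw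
  exact ⟨i % orderOf z, Nat.mod_lt _ hz, pow_mod_orderOf z i⟩

end CommGroup

/-! ### Rotations and the finite cyclic subgroups of `SO(2)`. -/

section Rotations

theorem R_add (α β : ℝ) : R (α + β) = R α * R β := by
  apply Subtype.ext
  ext i j
  fin_cases i <;> fin_cases j <;>
    simp [R, Real.cos_add, Real.sin_add] <;> ring

theorem R_zero : R 0 = 1 := by
  apply Subtype.ext
  ext i j
  fin_cases i <;> fin_cases j <;> simp [R]

theorem R_pi : R Real.pi = negI := by
  apply Subtype.ext
  ext i j
  fin_cases i <;> fin_cases j <;> simp [R, negI]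

/-- The first row is a point of the unit circle in `ℂ`; its argument is the angle. -/
theorem R_surjective : Function.Surjective R := by
  rintro ⟨M, hM⟩
  obtain ⟨h1, h2, h3⟩ := Matrix.mem_specialOrthogonalGroup_fin_two_iff.1 hM
  set z : ℂ := ⟨M 0 0, M 0 1⟩ with hz
  have hnorm : ‖z‖ = 1 := by
    rw [Complex.norm_def, Complex.normSq_mk, ← sq, ← sq, h3, Real.sqrt_one]
  have hcos : Real.cos z.arg = M 0 0 := by
    simpa [hnorm] using Complex.norm_mul_cos_arg z
  have hsin : Real.sin z.arg = M 0 1 := by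
    simpa [hnorm] using Complex.norm_mul_sin_arg z
  refine ⟨z.arg, Subtype.ext ?_⟩
  ext i j
  fin_cases i <;> fin_cases j <;> simp [R, hcos, hsin, h1, h2]

instance : CommGroup SO2 where
  mul_comm x y := by
    obtain ⟨α, rfl⟩ := R_surjective x
    obtain ⟨β, rfl⟩ := R_surjective y
    rw [← R_add, ← R_add, add_comm]

theorem R_nat_mul (k : ℕ) (θ : ℝ) : R (k * θ) = R θ ^ k := by
  induction k with
  | zero => simp [R_zero]
  | succ k ih => rw [pow_succ, ← ih, ← R_add]; congr 1; push_cast; ring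

theorem R_int_mul (k : ℤ) (θ : ℝ) : R (k * θ) = R θ ^ k := by
  obtain ⟨i, rfl | rfl⟩ := k.eq_nat_or_neg
  · simpa using R_nat_mul i θ
  · rw [zpow_neg, zpow_natCast, ← R_nat_mul, eq_inv_iff_mul_eq_one, ← R_add, ← R_zero]
    congr 1; push_cast; ring

theorem R_eq_one_iff (θ : ℝ) : R θ = 1 ↔ ∃ k : ℤ, k * (2 * Real.pi) = θ := by
  rw [← Real.cos_eq_one_iff]
  constructor
  · intro h
    have := congrFun (congrFun (congrArg Subtype.val h) 0) 0
    simpa [R] using this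
  · intro h
    have hs : Real.sin θ = 0 := by
      have := Real.sin_sq_add_cos_sq θ
      rw [h] at this
      nlinarith
    apply Subtype.ext
    ext i j
    fin_cases i <;> fin_cases j <;> simp [R, h, hs]

theorem mem_Cyc_iff {n : ℕ} (hn : 0 < n) (u : SO2) : u ∈ Cyc n ↔ u ^ n = 1 := by
  have hn' : (n : ℝ) ≠ 0 := by exact_mod_cast hn.ne'
  constructor
  · rintro ⟨k, rfl⟩
    change (R (2 * Real.pi / n) ^ k) ^ n = 1
    rw [← R_int_mul, ← R_nat_mul, R_eq_one_iff]
    exact ⟨k, by field_simp⟩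
  · intro h
    obtain ⟨θ, rfl⟩ := R_surjective u
    rw [← R_nat_mul, R_eq_one_iff] at h
    obtain ⟨k, hk⟩ := h
    refine ⟨k, ?_⟩
    change R (2 * Real.pi / n) ^ k = _
    rw [← R_int_mul]
    congr 1
    field_simp
    linarith

theorem orderOf_R_two_pi_div {n : ℕ} (hn : 0 < n) : orderOf (R (2 * Real.pi / n)) = n := by
  have hn' : (n : ℝ) ≠ 0 := by exact_mod_cast hn.ne'
  refine Nat.dvd_antisymm (orderOf_dvd_of_pow_eq_one
    ((mem_Cyc_iff hn _).1 (Subgroup.mem_zpowers _))) ?_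
  have h := pow_orderOf_eq_one (R (2 * Real.pi / n))
  rw [← R_nat_mul, R_eq_one_iff] at h
  obtain ⟨k, hk⟩ := h
  have hpi := Real.pi_ne_zero
  field_simp at hk
  refine Int.natCast_dvd_natCast.1 ⟨k, ?_⟩
  have : (orderOf (R (2 * Real.pi / n)) : ℝ) = n * k := by linarith
  exact_mod_cast this

theorem card_Cyc {n : ℕ} (hn : 0 < n) : Nat.card (Cyc n) = n := by
  rw [Cyc, Nat.card_zpowers, orderOf_R_two_pi_div hn]

theorem zpowers_eq_Cyc {x : SO2} {n : ℕ} (hn : 0 < n) (hx : orderOf x = n) :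
    Subgroup.zpowers x = Cyc n := by
  have : Finite (Cyc n) := Nat.finite_of_card_ne_zero (by rw [card_Cyc hn]; exact hn.ne')
  refine Subgroup.eq_of_le_of_card_ge (Subgroup.zpowers_le.2 ?_)
    (by rw [card_Cyc hn, Nat.card_zpowers, hx])
  rw [mem_Cyc_iff hn, ← hx, pow_orderOf_eq_one]

/-- If `2θ` is a multiple of `2π`, then `θ` is a multiple of `π`. This ties the abstract involutions
to class `E₁`. -/
theorem eq_negI_of_orderOf_eq_two {x : SO2} (hx : orderOf x = 2) : x = negI := by
  obtain ⟨θ, rfl⟩ := R_surjective x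
  have h2 := pow_orderOf_eq_one (R θ)
  rw [hx, ← R_nat_mul, R_eq_one_iff] at h2
  obtain ⟨k, hk⟩ := h2
  obtain rfl : θ = k * Real.pi := by push_cast at hk; linarith
  rcases Int.even_or_odd' k with ⟨j, rfl | rfl⟩
  · have : R (((2 * j : ℤ) : ℝ) * Real.pi) = 1 := (R_eq_one_iff _).2 ⟨j, by push_cast; ring⟩
    rw [this, orderOf_one] at hx
    norm_num at hx
  · have h1 : ((2 * j + 1 : ℤ) : ℝ) * Real.pi = j * (2 * Real.pi) + Real.pi := by push_cast; ring
    rw [h1, R_add, (R_eq_one_iff (j * (2 * Real.pi))).2 ⟨j, rfl⟩, one_mul, R_pi]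

theorem pow_two_pow_sub_one_eq_negI {x : SO2} {a : ℕ} (ha : 1 ≤ a) (hx : orderOf x = 2 ^ a) :
    x ^ 2 ^ (a - 1) = negI :=
  eq_negI_of_orderOf_eq_two (by simpa using orderOf_pow_prime_pow_sub Nat.prime_two hx ha)

theorem mem_CycProd_iff {n m : ℕ} (hn : 0 < n) (hm : 0 < m) (z : K) :
    z ∈ CycProd n m ↔ z.1 ^ n = 1 ∧ z.2 ^ m = 1 := by
  rw [CycProd, Subgroup.mem_prod, mem_Cyc_iff hn, mem_Cyc_iff hm]

end Rotations

/-! ### Angle parametrisation of the 2-component, and facts about blocks. -/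

theorem isCyclic_subgroup_iff {C : Subgroup K} :
    IsCyclic C ↔ ∃ z, Subgroup.zpowers z = C :=
  C.isCyclic_iff_exists_zpowers_eq_top

theorem negI_sq : negI ^ 2 = 1 := by
  rw [← R_pi, ← R_nat_mul, R_eq_one_iff]
  exact ⟨1, by push_cast; ring⟩

theorem negI_ne_one : negI ≠ 1 := by
  rw [← R_pi, Ne, R_eq_one_iff]
  rintro ⟨k, hk⟩
  have h1 : (k : ℝ) * 2 = 1 := by
    have := Real.pi_ne_zero
    field_simp at hk
    linarith
  have h2 : k * 2 = 1 := by exact_mod_cast h1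
  omega

theorem R_angle_eq_pow {a k : ℕ} (hk : k ≤ a) (r i : ℕ) :
    ((R (2 * Real.pi / 2 ^ k * r * i), R (2 * Real.pi / 2 ^ k * i)) : K) =
      (R (2 * Real.pi / (2 ^ a : ℕ)) ^ (r * 2 ^ (a - k)), R (2 * Real.pi / 2 ^ k)) ^ i := by
  refine Prod.ext ?_ ?_
  · simp only [Prod.pow_mk]
    rw [← pow_mul, ← R_nat_mul]
    congr 1
    have h : (2 : ℝ) ^ a = 2 ^ (a - k) * 2 ^ k := by rw [← pow_add, Nat.sub_add_cancel hk]
    push_cast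
    rw [h]
    field_simp
  · simp only [Prod.pow_mk]
    rw [← R_nat_mul, mul_comm]

theorem R_two_pi_div_pow {a k : ℕ} (hk : k ≤ a) :
    R (2 * Real.pi / (2 ^ a : ℕ)) ^ 2 ^ (a - k) = R (2 * Real.pi / 2 ^ k) := by
  have h := congrArg Prod.fst (R_angle_eq_pow hk 1 1)
  simpa using h.symm

theorem existsUnique_bijOn {a b : ℕ} {H : Subgroup K} {k c : ℕ} (hk1 : 1 ≤ k)
    (hk : k ≤ min a b) (hc : c < 2 ^ k) (hodd : Odd c)
    (hH : H = Subgroup.zpowers (R (2 * Real.pi / (2 ^ a : ℕ)) ^ (c * 2 ^ (a - k)),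
      R (2 * Real.pi / (2 ^ b : ℕ)) ^ 2 ^ (b - k))) :
    ∃! kr : ℕ × ℕ, 1 ≤ kr.1 ∧ kr.1 ≤ min a b ∧ kr.2 < 2 ^ kr.1 ∧ Odd kr.2 ∧
      Set.BijOn (fun i : ℕ => ((R (2 * Real.pi / 2 ^ kr.1 * kr.2 * i),
        R (2 * Real.pi / 2 ^ kr.1 * i)) : K)) (Set.Iio (2 ^ kr.1)) (H : Set K) := by
  have hka : k ≤ a := hk.trans (min_le_left _ _)
  have hkb : k ≤ b := hk.trans (min_le_right _ _)
  rw [R_two_pi_div_pow hkb] at hH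
  set w := R (2 * Real.pi / 2 ^ k) with hw
  have hwo : orderOf w = 2 ^ k := by
    have := orderOf_R_two_pi_div (n := 2 ^ k) (by positivity)
    rw [← this, hw]
    push_cast
    rfl
  set u := R (2 * Real.pi / (2 ^ a : ℕ)) with hu
  have huw : u ^ 2 ^ (a - k) = w := R_two_pi_div_pow hka
  have hucw : ∀ r : ℕ, u ^ (r * 2 ^ (a - k)) = w ^ r := fun r => by
    rw [mul_comm, pow_mul, huw]
  have hzo : orderOf ((u ^ (c * 2 ^ (a - k)), w) : K) = 2 ^ k := by
    rw [Prod.orderOf_mk, hwo, hucw]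
    exact Nat.lcm_eq_right (hwo ▸ orderOf_pow_dvd c)
  have hbij := bijOn_pow_zpowers (z := ((u ^ (c * 2 ^ (a - k)), w) : K))
    (by rw [hzo]; positivity)
  rw [← hH, hzo] at hbij
  refine ⟨(k, c), ⟨hk1, hk, hc, hodd, ?_⟩, ?_⟩
  · simpa only [R_angle_eq_pow hka] using hbij
  · rintro ⟨k', r⟩ ⟨hk1', hk', hr, -, hbij'⟩
    dsimp only at hk1' hk' hr hbij'
    -- The cardinality of `H` determines `k`; then `r` is read off from the only point of `H` with
    -- second coordinate `w`.
    obtain rfl : k' = k := by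
      have h1 := hbij.image_eq ▸ hbij'.image_eq
      have h2 := congrArg Set.ncard h1
      rw [hbij'.injOn.ncard_image, hbij.injOn.ncard_image,
        ← Finset.coe_Iio, ← Finset.coe_Iio, Set.ncard_coe_finset, Set.ncard_coe_finset,
        Nat.card_Iio, Nat.card_Iio] at h2
      exact Nat.pow_right_injective le_rfl h2
    simp only [R_angle_eq_pow hka, ← hu, ← hw, hucw] at hbij'
    have hone : 1 < 2 ^ k' := Nat.one_lt_two_pow (by omega)
    obtain ⟨i, hi, hiz⟩ := hbij.surjOn (hbij'.mapsTo (Set.mem_Iio.2 hone))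
    simp only [Prod.pow_mk, pow_one, hucw, Prod.mk.injEq] at hiz
    obtain rfl : i = 1 :=
      pow_injOn_Iio_orderOf (x := w) (by rwa [hwo]) (by rwa [hwo]) (by simpa using hiz.2)
    have : r = c := pow_injOn_Iio_orderOf (x := w) (Set.mem_Iio.2 (by rwa [hwo]))
      (Set.mem_Iio.2 (by rwa [hwo])) (by simpa using hiz.1.symm)
    rw [this]

theorem Block.Admissible.mul_ne_zero {ty : Block} {p a b k l c : ℕ}
    (h : ty.Admissible p a b k l c) (hty : ty.IsTwoGen) : a * b ≠ 0 := by
  have : 1 ≤ a ∧ 1 ≤ b := by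
    cases ty <;> simp only [Block.Admissible, Block.IsTwoGen, le_min_iff] at h hty <;> omega
  exact Nat.mul_ne_zero (by omega) (by omega)

theorem Block.coeff_eq_zero_of_not_isTwoGen {ty : Block} (hty : ¬ ty.IsTwoGen) (p a b l : ℕ) :
    ty.coeffA2 p a l = 0 ∧ ty.coeffB2 p b l = 0 := by
  cases ty <;> simp_all [Block.IsTwoGen, Block.coeffA2, Block.coeffB2]

/-! ### Exponents in the prime factorization. -/

section PrimeFactorization

variable {s : ℕ} {p a : Fin s → ℕ} {n : ℕ}

theorem pairwise_coprime_prime_pow (hp : ∀ i, (p i).Prime) (hpinj : Function.Injective p)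
    (e : Fin s → ℕ) : Pairwise fun i j => Nat.Coprime (p i ^ e i) (p j ^ e j) :=
  fun i j hij => Nat.coprime_pow_primes _ _ (hp i) (hp j) (hpinj.ne hij)

theorem pow_dvd_of_eq_prod (hna : n = ∏ i, p i ^ a i) (i : Fin s) : p i ^ a i ∣ n :=
  hna ▸ Finset.dvd_prod_of_mem (fun i => p i ^ a i) (Finset.mem_univ i)

theorem one_le_exponent_zero [NeZero s] (hp : ∀ i, (p i).Prime) (hpinj : Function.Injective p)
    (hp0 : p 0 = 2) (hne : Even n) (hna : n = ∏ i, p i ^ a i) : 1 ≤ a 0 := by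
  have h2 : 2 ∣ ∏ i, p i ^ a i := hna ▸ hne.two_dvd
  obtain ⟨i, -, hi⟩ := (Nat.prime_two.prime.dvd_finsetProd_iff _).1 h2
  have h := (Nat.prime_dvd_prime_iff_eq Nat.prime_two (hp i)).1 (Nat.prime_two.dvd_of_dvd_pow hi)
  obtain rfl : i = 0 := hpinj (by rw [hp0, h])
  by_contra h0
  rw [show a 0 = 0 by omega, pow_zero] at hi
  omega

/-- The order of `u` is a power of `p i` dividing `n`, hence coprime to the other prime power
factors of `n`. -/
theorem pow_eq_one_of_pow_eq_one {G : Type*} [Group G] (hp : ∀ i, (p i).Prime)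
    (hpinj : Function.Injective p) (hna : n = ∏ i, p i ^ a i) {u : G} (hu : u ^ n = 1)
    {i : Fin s} {e : ℕ} (hue : u ^ p i ^ e = 1) : u ^ p i ^ a i = 1 := by
  classical
  have hco : Nat.Coprime (p i ^ e) (∏ j ∈ Finset.univ.erase i, p j ^ a j) :=
    Nat.Coprime.prod_right fun j hj =>
      Nat.coprime_pow_primes _ _ (hp i) (hp j) (hpinj.ne (Finset.ne_of_mem_erase hj).symm)
  have h1 := orderOf_dvd_of_pow_eq_one hu
  rw [hna, ← Finset.mul_prod_erase _ _ (Finset.mem_univ i)] at h1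
  exact orderOf_dvd_iff_pow_eq_one.1
    ((hco.coprime_dvd_left (orderOf_dvd_of_pow_eq_one hue)).dvd_of_dvd_mul_right h1)

end PrimeFactorization

end TorusSubgroups

/-! ### Assembling the primary components. -/

open TorusSubgroups in
theorem mainTheorem9
    (n m : ℕ) (hn : 0 < n) (hm : 0 < m) (hne : Even n) (hme : Even m)
    (s : ℕ) [NeZero s] (p a b : Fin s → ℕ)
    (hp : ∀ i, (p i).Prime) (hpinj : Function.Injective p) (hp0 : p 0 = 2)
    (hna : n = ∏ i, p i ^ a i) (hmb : m = ∏ i, p i ^ b i) :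
    -- the decomposition of `C_n × C_m`
    (1 ≤ a 0 ∧ 1 ≤ b 0 ∧ (∀ i, i ≠ 0 → Odd (p i)) ∧
      IsDirectProduct (CycProd n m) (fun i => CycProd (p i ^ a i) (p i ^ b i))) ∧
    ∀ C : Subgroup K, HasTwoGenerators C → InClassE1 n m C →
      -- the unique decomposition of `C`, and the description of its components
      (∃ A : Fin s → Subgroup K,
        ((∀ i, A i ≤ CycProd (p i ^ a i) (p i ^ b i)) ∧ IsDirectProduct C A) ∧
        (∀ A' : Fin s → Subgroup K,
          (∀ i, A' i ≤ CycProd (p i ^ a i) (p i ^ b i)) → IsDirectProduct C A' → A' = A) ∧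
        A 0 ≠ ⊥ ∧ IsCyclic (A 0) ∧
        (∃! kr : ℕ × ℕ, 1 ≤ kr.1 ∧ kr.1 ≤ min (a 0) (b 0) ∧ kr.2 < 2 ^ kr.1 ∧ Odd kr.2 ∧
          Set.BijOn
            (fun i : ℕ => ((R (2 * Real.pi / 2 ^ kr.1 * kr.2 * i),
              R (2 * Real.pi / 2 ^ kr.1 * i)) : K))
            (Set.Iio (2 ^ kr.1)) (A 0 : Set K)) ∧
        (∃ i, i ≠ 0 ∧ HasTwoGenerators (A i))) ∧
      -- two explicit generators of `C`
      (∀ x y : SO2, Subgroup.zpowers x = Cyc n → Subgroup.zpowers y = Cyc m →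
        ∃ (ty : Fin s → Block) (k l c : Fin s → ℕ),
          (∀ i, (ty i).Admissible (p i) (a i) (b i) (k i) (l i) (c i)) ∧
          ty 0 = Block.nu ∧ Odd (c 0) ∧
          (∃ i, (ty i).IsTwoGen ∧ a i * b i ≠ 0) ∧
          C = Subgroup.closure
            {(x ^ expA1 p a k c ty n, y ^ expB1 p b k c ty m),
             (x ^ expA2 p a l ty n, y ^ expB2 p b l ty m)}) := by

  -- The exponent `a i + b i` kills both coordinates at once, and the product of these prime powers
  -- is simply `n * m`.
  have hq := pairwise_coprime_prime_pow hp hpinj (fun i => a i + b i)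
  have hpa : ∀ i, 0 < p i ^ a i := fun i => pow_pos (hp i).pos _
  have hpb : ∀ i, 0 < p i ^ b i := fun i => pow_pos (hp i).pos _
  have ha0 := one_le_exponent_zero hp hpinj hp0 hne hna
  have hb0 := one_le_exponent_zero hp hpinj hp0 hme hmb
  have hdn := pow_dvd_of_eq_prod hna
  have hdm := pow_dvd_of_eq_prod hmb
  set P : Fin s → Subgroup K := fun i => CycProd (p i ^ a i) (p i ^ b i) with hP
  have hPle : ∀ i, P i ≤ CycProd n m := fun i z hz => by
    rw [hP, mem_CycProd_iff (hpa i) (hpb i)] at hz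
    rw [mem_CycProd_iff hn hm]
    exact ⟨orderOf_dvd_iff_pow_eq_one.1 ((orderOf_dvd_of_pow_eq_one hz.1).trans (hdn i)),
      orderOf_dvd_iff_pow_eq_one.1 ((orderOf_dvd_of_pow_eq_one hz.2).trans (hdm i))⟩
  have hPq : ∀ i, ∀ z ∈ P i, z ^ p i ^ (a i + b i) = 1 := fun i z hz => by
    rw [hP, mem_CycProd_iff (hpa i) (hpb i)] at hz
    exact Prod.ext (pow_pow_eq_one_of_le (Nat.le_add_right _ _) hz.1)
      (pow_pow_eq_one_of_le (Nat.le_add_left _ _) hz.2)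
  have hPind : iSupIndep P := iSupIndep_of_pow_eq_one hq hPq
  have hkill : ∀ z ∈ CycProd n m, z ^ ∏ i, p i ^ (a i + b i) = 1 := fun z hz => by
    rw [mem_CycProd_iff hn hm] at hz
    have hprod : ∏ i, p i ^ (a i + b i) = n * m := by
      rw [hna, hmb, ← Finset.prod_mul_distrib]
      exact Finset.prod_congr rfl fun i _ => pow_add _ _ _
    rw [hprod]
    exact Prod.ext (by rw [Prod.pow_fst, pow_mul, hz.1, one_pow]; rfl)
      (by rw [Prod.pow_snd, mul_comm, pow_mul, hz.2, one_pow]; rfl)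
  have hmemP : ∀ z ∈ CycProd n m, ∀ i, z ^ p i ^ (a i + b i) = 1 → z ∈ P i := by
    intro z hz i hzi
    rw [mem_CycProd_iff hn hm] at hz
    rw [hP, mem_CycProd_iff (hpa i) (hpb i)]
    exact ⟨pow_eq_one_of_pow_eq_one hp hpinj hna hz.1 (congrArg Prod.fst hzi),
      pow_eq_one_of_pow_eq_one hp hpinj hmb hz.2 (congrArg Prod.snd hzi)⟩
  have hsup : ∀ C : Subgroup K, C ≤ CycProd n m → ⨆ i, C ⊓ P i = C := fun C hC =>
    le_antisymm (iSup_le fun i => inf_le_left)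
      (le_of_pow_eq_one_imp_mem hq (fun z hz => hkill z (hC hz)) fun z hz i hzi =>
        Subgroup.mem_iSup_of_mem i ⟨hz, hmemP z (hC hz) i hzi⟩)
  refine ⟨⟨ha0, hb0, fun i hi => ?_, hPind, ?_⟩, fun C hC2 hCE => ?_⟩
  · refine (hp i).odd_of_ne_two fun h2 => hi (hpinj (by rw [h2, hp0]))
  · conv_rhs => rw [← hsup _ le_rfl]
    exact iSup_congr fun i => (inf_eq_right.2 (hPle i)).symm
  have hCsup := hsup C hCE.le_cycProd
  have hzpow : ∀ {N M : ℕ} {x y : SO2}, 0 < N → 0 < M → orderOf x = N → orderOf y = M →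
      (Subgroup.zpowers x).prod (Subgroup.zpowers y) = CycProd N M := fun hN hM hx hy => by
    rw [zpowers_eq_Cyc hN hx, zpowers_eq_Cyc hM hy, CycProd]
  have hAA : (negI, negI) ∈ C := hCE.contains_A (by simp)
  have hAP : (negI, negI) ∈ P 0 := by
    refine hmemP _ (hCE.le_cycProd hAA) 0 ?_
    rw [hp0]
    refine orderOf_dvd_iff_pow_eq_one.1 ((orderOf_dvd_of_pow_eq_one
      (show ((negI, negI) : K) ^ 2 = 1 from Prod.ext negI_sq negI_sq)).trans (dvd_pow_self 2 (by omega)))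
  -- Multiplication by `(-I, -I)` exchanges these two elements, so either one would bring all of `D`
  -- into `C`.
  have hnotD : (negI, 1) ∉ C ∧ (1, negI) ∉ C := by
    constructor <;>
    · intro h
      have h' := C.mul_mem h hAA
      rw [Prod.mk_mul_mk, one_mul, ← sq, negI_sq] at h'
      refine hCE.not_contains_D ?_
      rintro z (rfl | rfl | rfl | rfl) <;> first | exact C.one_mem | assumption
  have htwo : ∀ x y : SO2, orderOf x = 2 ^ a 0 → orderOf y = 2 ^ b 0 →
      ∃ k c, 1 ≤ k ∧ k ≤ min (a 0) (b 0) ∧ c < 2 ^ k ∧ Odd c ∧ C ⊓ P 0 =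
        Subgroup.zpowers (x ^ (c * 2 ^ (a 0 - k)), y ^ 2 ^ (b 0 - k)) := by
    intro x y hx hy
    refine exists_eq_zpowers_of_unique_involution hb0 hx hy ?_ ?_ ?_ ?_
    · rw [hzpow (by positivity) (by positivity) hx hy]
      have hle : C ⊓ P 0 ≤ CycProd (p 0 ^ a 0) (p 0 ^ b 0) := inf_le_right
      rwa [hp0] at hle
    all_goals simp only [pow_two_pow_sub_one_eq_negI ha0 hx, pow_two_pow_sub_one_eq_negI hb0 hy]
    exacts [⟨hAA, hAP⟩, fun h => hnotD.1 h.1, fun h => hnotD.2 h.1]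
  have hblock : ∀ x y : SO2, orderOf x = n → orderOf y = m → ∀ i,
      ∃ (ty : Block) (k l c : ℕ), ty.Admissible (p i) (a i) (b i) k l c ∧
        (i = 0 → ty = Block.nu ∧ Odd c) ∧ C ⊓ P i = Subgroup.closure
          {((x ^ (n / p i ^ a i)) ^ ty.coeffA1 (p i) (a i) k c,
            (y ^ (m / p i ^ b i)) ^ ty.coeffB1 (p i) (b i) k c),
           ((x ^ (n / p i ^ a i)) ^ ty.coeffA2 (p i) (a i) l,
            (y ^ (m / p i ^ b i)) ^ ty.coeffB2 (p i) (b i) l)} := by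
    intro x y hx hy i
    have hxi : orderOf (x ^ (n / p i ^ a i)) = p i ^ a i := by
      rw [orderOf_pow_of_dvd (Nat.div_pos (Nat.le_of_dvd hn (hdn i)) (hpa i)).ne'
        (by rw [hx]; exact Nat.div_dvd_of_dvd (hdn i)), hx, Nat.div_div_self (hdn i) hn.ne']
    have hyi : orderOf (y ^ (m / p i ^ b i)) = p i ^ b i := by
      rw [orderOf_pow_of_dvd (Nat.div_pos (Nat.le_of_dvd hm (hdm i)) (hpb i)).ne'
        (by rw [hy]; exact Nat.div_dvd_of_dvd (hdm i)), hy, Nat.div_div_self (hdm i) hm.ne']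
    by_cases hi : i = 0
    · subst hi
      obtain ⟨k, c, -, hk, hc, hodd, hcl⟩ := htwo _ _ (hp0 ▸ hxi) (hp0 ▸ hyi)
      refine ⟨.nu, k, 0, c, ⟨hk, hp0 ▸ hc⟩, fun _ => ⟨rfl, hodd⟩, ?_⟩
      rw [hcl, Set.pair_comm]
      simp only [Block.coeffA1, Block.coeffB1, Block.coeffA2, Block.coeffB2, pow_zero]
      rw [← Prod.one_eq_mk, Subgroup.closure_insert_one, ← Subgroup.zpowers_eq_closure]
      simp only [hp0]
    · obtain ⟨ty, k, l, c, hadm, hcl⟩ := exists_block_closure_eq (H := C ⊓ P i) (hp i) hxi hyi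
        (by rw [hzpow (hpa i) (hpb i) hxi hyi]; exact inf_le_right)
      exact ⟨ty, k, l, c, hadm, fun h => absurd h hi, hcl⟩
  obtain ⟨k, c, hk1, hk, hc, hodd, hcl⟩ := htwo _ _
    (orderOf_R_two_pi_div (n := 2 ^ a 0) (by positivity))
    (orderOf_R_two_pi_div (n := 2 ^ b 0) (by positivity))
  have hcyc0 : IsCyclic ↥(C ⊓ P 0) := isCyclic_subgroup_iff.2 ⟨_, hcl.symm⟩
  refine ⟨⟨fun i => C ⊓ P i, ⟨fun i => inf_le_right, hPind.mono fun i => inf_le_right, hCsup⟩,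
    fun A' hA' hA'C => funext fun i => ?_, ?_, hcyc0,
    existsUnique_bijOn hk1 hk hc hodd hcl, ?_⟩, ?_⟩
  · rw [eq_iSup_inf_of_iSupIndep hPind hA' i, hA'C.2]
  · intro hbot
    have : ((negI, negI) : K) ∈ (⊥ : Subgroup K) := hbot ▸ ⟨hAA, hAP⟩
    exact negI_ne_one (congrArg Prod.fst (Subgroup.mem_bot.1 this))
  · by_contra! hno
    have hcyc : ∀ i, IsCyclic ↥(C ⊓ P i) := by
      intro i
      by_cases hi : i = 0
      · exact hi ▸ hcyc0
      by_contra hnc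
      obtain ⟨ty, k, l, c, -, -, hcl⟩ :=
        hblock _ _ (orderOf_R_two_pi_div hn) (orderOf_R_two_pi_div hm) i
      exact hno i hi ⟨hnc, _, _, hcl⟩
    choose z hz using fun i => isCyclic_subgroup_iff.1 (hcyc i)
    apply hC2.1
    have hzi : ∀ i, z i ∈ C ⊓ P i := fun i => hz i ▸ Subgroup.mem_zpowers _
    -- With trivial second generators, the product of the cyclic generators alone generates `C`.
    have := closure_prod_pair_eq_iSup hq z 1 (fun i => hPq i _ (hzi i).2) (fun i => one_pow _)
    simp only [Pi.one_apply, Finset.prod_const_one] at this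
    have hCz : C = Subgroup.closure {∏ i, z i, 1} := by
      rw [this]
      conv_lhs => rw [← hCsup]
      refine iSup_congr fun i => ?_
      rw [← hz i, Set.pair_comm, Subgroup.closure_insert_one, Subgroup.zpowers_eq_closure]
    rw [hCz]
    exact isCyclic_closure_pair_one _
  · intro x y hx hy
    have hxo : orderOf x = n := by rw [← Nat.card_zpowers, hx, card_Cyc hn]
    have hyo : orderOf y = m := by rw [← Nat.card_zpowers, hy, card_Cyc hm]
    choose ty k l c hadm h0 hcl using hblock x y hxo hyo
    have hCgen : C = Subgroup.closure
        {(x ^ expA1 p a k c ty n, y ^ expB1 p b k c ty m),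
         (x ^ expA2 p a l ty n, y ^ expB2 p b l ty m)} := by
      have hsub : ∀ i, ∀ v ∈ ({((x ^ (n / p i ^ a i)) ^ (ty i).coeffA1 (p i) (a i) (k i) (c i),
            (y ^ (m / p i ^ b i)) ^ (ty i).coeffB1 (p i) (b i) (k i) (c i)),
           ((x ^ (n / p i ^ a i)) ^ (ty i).coeffA2 (p i) (a i) (l i),
            (y ^ (m / p i ^ b i)) ^ (ty i).coeffB2 (p i) (b i) (l i))} : Set K),
          v ^ p i ^ (a i + b i) = 1 := fun i v hv =>
        hPq i v (show v ∈ C ⊓ P i from hcl i ▸ Subgroup.subset_closure hv).2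
      conv_lhs => rw [← hCsup, iSup_congr hcl]
      rw [← closure_prod_pair_eq_iSup hq _ _ (fun i => hsub i _ (by simp))
        (fun i => hsub i _ (by simp))]
      have hprod : ∀ {N : ℕ} {e : Fin s → ℕ} (t : SO2) (f : Fin s → ℕ),
          ∏ i, (t ^ (N / p i ^ e i)) ^ f i = t ^ ∑ i, f i * (N / p i ^ e i) := fun t f => by
        rw [← Finset.prod_pow_eq_pow_sum]
        exact Finset.prod_congr rfl fun i _ => by rw [← pow_mul, mul_comm]
      have hpair : ∀ f g : Fin s → SO2, ∏ i, ((f i, g i) : K) = (∏ i, f i, ∏ i, g i) :=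
        fun f g => Prod.ext (Prod.fst_prod ..) (Prod.snd_prod ..)
      simp only [hpair, hprod, expA1, expB1, expA2, expB2]
    refine ⟨ty, k, l, c, hadm, (h0 0 rfl).1, (h0 0 rfl).2, ?_, hCgen⟩
    by_contra! hno
    have hnot : ∀ i, ¬ (ty i).IsTwoGen := fun i h => (hadm i).mul_ne_zero h (hno i h)
    have hA2 : expA2 p a l ty n = 0 := Finset.sum_eq_zero fun i _ => by
      rw [(Block.coeff_eq_zero_of_not_isTwoGen (hnot i) (p i) (a i) (b i) (l i)).1, zero_mul]
    have hB2 : expB2 p b l ty m = 0 := Finset.sum_eq_zero fun i _ => by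
      rw [(Block.coeff_eq_zero_of_not_isTwoGen (hnot i) (p i) (a i) (b i) (l i)).2, zero_mul]
    rw [hA2, hB2, pow_zero, pow_zero, ← Prod.one_eq_mk] at hCgen
    exact hC2.1 (hCgen ▸ isCyclic_closure_pair_one _)
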